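/- Let $\mathbb K\langle z\rangle$ denote one of the following three rings of functions: (i) the ring $\mathbb C\langle z\rangle$ of entire functions, with $\mathbb K=\mathbb C$; (ii) the ring $\mathbb R\langle x\rangle$ of real analytic functions on $\mathbb R$, with $\mathbb K=\mathbb R$; (iii) the ring $\mathbb C\langle x\rangle$ of entire functions $\sum_{n\ge 0}a_nz^n$ with all $a_n\in\mathbb R$, with $\mathbb K=\mathbb C$. For $f\in\mathbb K\langle z\rangle$ let $Z_f=\{x\in\mathbb K : f(x)=0\}$, and for an ideal $I$ let $Z[I]=\{Z_f : f\in I\}$. Let $\mathcal D(\mathbb K)$ be the family of all closed discrete subsets of $\mathbb K$, together with $\mathbb K$ itself. A discrete $z$-filter on $\mathbb K$ is a subfamily $\mathcal F\subseteq\mathcal D(\mathbb K)$ with $\emptyset\notin\mathcal F$ that is closed under binary intersections and under passing to larger members of $\mathcal D(\mathbb K)$; a discrete $z$-ultrafilter is a maximal discrete $z$-filter. Let $\theta\mathbb K$ be the set of discrete $z$-ultrafilters on $\mathbb K$, the one belonging to $p\in\theta\mathbb K$ being written $\mathcal D^p$, with the topology for which the sets $\overline Z=\{p\in\theta\mathbb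 K : Z\in\mathcal D^p\}$, $Z\subseteq\mathbb K$ closed and discrete, form a base of closed sets. Let $\eta_{\mathbb K}:\mathbb K\to\theta\mathbb K$ send $x$ to the discrete $z$-ultrafilter $\{Z\in\mathcal D(\mathbb K) : x\in Z\}$. For $p\in\theta\mathbb K$ let $M^p=\{f\in\mathbb K\langle z\rangle : Z_f\in\mathcal D^p\}$ be the ideal of $\mathbb K\langle z\rangle$ corresponding to $\mathcal D^p$. Theorem. For each of the three rings and every $p\in\theta\mathbb K$, $M^p$ is a maximal ideal of $\mathbb K\langle z\rangle$ and $$M^p=\{f\in\mathbb K\langle z\rangle : p\in\mathrm{cl}_{\theta\mathbb K}(\eta_{\mathbb K}(Z_f))\},$$ and every maximal ideal of $\mathbb K\langle z\rangle$ is of the form $M^p$ for some $p\in\theta\mathbb K$. For the rings (i) and (ii), moreover, $Z[M^p]=\mathcal D^p$, and the point $p$ with $M=M^p$ is unique. For the ring (iii), $Z[M^p]$ consists of the members of $\mathcal D^p$ that are invariant under complex conjugation, and $M^p=M^q$ if and only if $\mathcal D^p=\mathcal D^q$ or $\mathcal D^p=\{\overline{Z}^{\,\mathrm{conj}} : Z\in\mathcal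 D^q\}$, where $\overline{Z}^{\,\mathrm{conj}}=\{\bar z : z\in Z\}$. -/

import Mathlib

namespace DiscreteZ

section General

variable (𝕜 : Type) [RCLike 𝕜]

/-- The family `D(𝕜)`: all closed discrete subsets of `𝕜`, together with the special member `𝕜`. -/
def closedDiscreteSets : Set (Set 𝕜) :=
  {Z | (IsClosed Z ∧ IsDiscrete Z) ∨ Z = Set.univ}

variable {𝕜}

/-- A discrete `z`-filter on `𝕜`: a subfamily of `D(𝕜)` without the empty set, closed under binary
intersections and under passing to larger members of `D(𝕜)`. -/
structure IsDiscreteZFilter (F : Set (Set 𝕜)) : Prop where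
  subset : F ⊆ closedDiscreteSets 𝕜
  empty_notMem : ∅ ∉ F
  inter_mem : ∀ D₁ ∈ F, ∀ D₂ ∈ F, D₁ ∩ D₂ ∈ F
  mem_of_superset : ∀ D₁ ∈ F, ∀ D ∈ closedDiscreteSets 𝕜, D₁ ⊆ D → D ∈ F

variable (𝕜)

/-- The set `θ𝕜` of discrete `z`-ultrafilters on `𝕜`, i.e. of maximal discrete `z`-filters. For a point
`p` of `θ𝕜`, `p.sets` is the discrete `z`-ultrafilter `D^p`. -/
@[ext]
structure Theta where
  sets : Set (Set 𝕜)
  isDiscreteZFilter : IsDiscreteZFilter sets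
  maximal : ∀ G : Set (Set 𝕜), IsDiscreteZFilter G → sets ⊆ G → G = sets

variable {𝕜}

/-- The set `Z̄ = {p ∈ θ𝕜 : Z ∈ D^p}`. -/
def basicClosed (Z : Set 𝕜) : Set (Theta 𝕜) := {p | Z ∈ p.sets}

/-- The topology of `θ𝕜`, with the sets `Z̄`, `Z` closed and discrete in `𝕜`, as basic closed sets. -/
instance : TopologicalSpace (Theta 𝕜) :=
  TopologicalSpace.generateFrom
    {U | ∃ Z : Set 𝕜, IsClosed Z ∧ IsDiscrete Z ∧ U = (basicClosed Z)ᶜ}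

theorem singleton_mem_closedDiscreteSets (x : 𝕜) : {x} ∈ closedDiscreteSets 𝕜 :=
  Or.inl ⟨isClosed_singleton, Set.subsingleton_singleton.isDiscrete⟩

theorem inter_mem_closedDiscreteSets {Z W : Set 𝕜} (hZ : Z ∈ closedDiscreteSets 𝕜)
    (hW : W ∈ closedDiscreteSets 𝕜) : Z ∩ W ∈ closedDiscreteSets 𝕜 := by
  rcases hZ with ⟨hc, hd⟩ | rfl
  · rcases hW with ⟨hc', -⟩ | rfl
    · exact Or.inl ⟨hc.inter hc', hd.mono Set.inter_subset_left⟩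
    · exact Or.inl (by simpa using ⟨hc, hd⟩)
  · simpa using hW

/-- The map `η : 𝕜 → θ𝕜` that sends `x` to the discrete `z`-ultrafilter fixed at `x`. -/
def eta (x : 𝕜) : Theta 𝕜 where
  sets := {Z | Z ∈ closedDiscreteSets 𝕜 ∧ x ∈ Z}
  isDiscreteZFilter :=
    { subset := fun _ h => h.1
      empty_notMem := fun h => h.2
      inter_mem := fun _ h₁ _ h₂ => ⟨inter_mem_closedDiscreteSets h₁.1 h₂.1, h₁.2, h₂.2⟩
      mem_of_superset := fun _ h₁ _ hD hs => ⟨hD, hs h₁.2⟩ }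
  maximal := by
    intro G hG hs
    refine Set.Subset.antisymm (fun Z hZ => ⟨hG.subset hZ, ?_⟩) hs
    by_contra hx
    have h := hG.inter_mem _ hZ _ (hs ⟨singleton_mem_closedDiscreteSets x, rfl⟩)
    rw [Set.inter_singleton_eq_empty.2 hx] at h
    exact hG.empty_notMem h

/-- The zero set `Z_f`. -/
def zeroSet (f : 𝕜 → 𝕜) : Set 𝕜 := {x | f x = 0}

variable (𝕜)

/-- The ring of functions `𝕜 → 𝕜` that are analytic on all of `𝕜`. For `𝕜 = ℂ` this is the ring `ℂ⟨z⟩` of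
entire functions, for `𝕜 = ℝ` the ring `ℝ⟨x⟩` of real analytic functions on the line. -/
def analyticFunctions : Subring (𝕜 → 𝕜) where
  carrier := {f | AnalyticOnNhd 𝕜 f Set.univ}
  mul_mem' hf hg := hf.mul hg
  one_mem' := analyticOnNhd_const
  add_mem' hf hg := hf.add hg
  zero_mem' := analyticOnNhd_const
  neg_mem' hf := hf.neg

variable {𝕜}

theorem zeroSet_mem_closedDiscreteSets {f : 𝕜 → 𝕜} (hf : f ∈ analyticFunctions 𝕜) :
    zeroSet f ∈ closedDiscreteSets 𝕜 := by
  have hf' : AnalyticOnNhd 𝕜 f Set.univ := hf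
  by_cases h : ∃ x, ∃ᶠ y in nhdsWithin x {x}ᶜ, f y = 0
  · obtain ⟨x, hx⟩ := h
    right
    ext y
    simpa [zeroSet] using hf'.eqOn_zero_of_preconnected_of_frequently_eq_zero
      isPreconnected_univ (Set.mem_univ x) hx (Set.mem_univ y)
  · left
    rw [isClosed_and_discrete_iff]
    intro x
    rw [Filter.disjoint_principal_right]
    exact Filter.not_frequently.1 fun hx => h ⟨x, hx⟩

section Ideals

variable (A : Subring (𝕜 → 𝕜))

/-- The family of zero sets `Z[I] = {Z_f : f ∈ I}` of an ideal `I`. -/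
def zeroSets {A : Subring (𝕜 → 𝕜)} (I : Ideal A) : Set (Set 𝕜) :=
  {Z | ∃ f ∈ I, Z = zeroSet (f : 𝕜 → 𝕜)}

theorem univ_mem_sets (p : Theta 𝕜) : Set.univ ∈ p.sets := by
  have hu : (Set.univ : Set 𝕜) ∈ closedDiscreteSets 𝕜 := Or.inr rfl
  by_cases hne : p.sets.Nonempty
  · obtain ⟨Z, hZ⟩ := hne
    exact p.isDiscreteZFilter.mem_of_superset Z hZ _ hu (Set.subset_univ Z)
  · have he : p.sets = ∅ := Set.not_nonempty_iff_eq_empty.1 hne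
    have h := p.maximal (eta (0 : 𝕜)).sets (eta (0 : 𝕜)).isDiscreteZFilter (by simp [he])
    rw [← h]
    exact ⟨hu, Set.mem_univ _⟩

/-- The ideal `M^p = Z⁻¹[D^p] = {f ∈ A : Z_f ∈ D^p}` of a ring `A` of analytic functions that
corresponds to the discrete `z`-ultrafilter `D^p`. -/
def idealAt (hA : A ≤ analyticFunctions 𝕜) (p : Theta 𝕜) : Ideal A where
  carrier := {f | zeroSet (f : 𝕜 → 𝕜) ∈ p.sets}
  add_mem' := by
    intro f g hf hg
    refine p.isDiscreteZFilter.mem_of_superset _ (p.isDiscreteZFilter.inter_mem _ hf _ hg) _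
      (zeroSet_mem_closedDiscreteSets (hA (f + g).2)) ?_
    rintro x ⟨h₁, h₂⟩
    have h₁' : (f : 𝕜 → 𝕜) x = 0 := h₁
    have h₂' : (g : 𝕜 → 𝕜) x = 0 := h₂
    simp [zeroSet, h₁', h₂']
  zero_mem' := by
    have h : zeroSet (((0 : A) : 𝕜 → 𝕜)) = Set.univ := by ext x; simp [zeroSet]
    show zeroSet (((0 : A) : 𝕜 → 𝕜)) ∈ p.sets
    rw [h]
    exact univ_mem_sets p
  smul_mem' := by
    intro c f hf
    refine p.isDiscreteZFilter.mem_of_superset _ hf _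
      (zeroSet_mem_closedDiscreteSets (hA (c • f).2)) ?_
    intro x h
    have h' : (f : 𝕜 → 𝕜) x = 0 := h
    simp [zeroSet, h']

end Ideals

end General

theorem hasSum_real_mul {f g : ℂ → ℂ} {a b : ℕ → ℝ}
    (ha : ∀ z : ℂ, HasSum (fun n => (a n : ℂ) * z ^ n) (f z))
    (hb : ∀ z : ℂ, HasSum (fun n => (b n : ℂ) * z ^ n) (g z)) (z : ℂ) :
    HasSum (fun n => ((∑ kl ∈ Finset.HasAntidiagonal.antidiagonal n, a kl.1 * b kl.2 : ℝ) : ℂ) * z ^ n)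
      (f z * g z) := by
  have ha' := (ha z).summable.norm
  have hb' := (hb z).summable.norm
  have hs := (summable_norm_sum_mul_antidiagonal_of_summable_norm ha' hb').of_norm.hasSum
  rw [← tsum_mul_tsum_eq_tsum_sum_antidiagonal_of_summable_norm ha' hb', (ha z).tsum_eq,
    (hb z).tsum_eq] at hs
  refine Eq.mp (congrArg (fun F : ℕ → ℂ => HasSum F (f z * g z)) (funext fun n => ?_)) hs
  rw [Complex.ofReal_sum, Finset.sum_mul]
  refine Finset.sum_congr rfl fun kl hkl => ?_
  rw [← Finset.HasAntidiagonal.mem_antidiagonal.1 hkl, pow_add]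
  push_cast
  ring

/-- The ring `ℂ⟨x⟩` of entire functions `z ↦ ∑ aₙ zⁿ` of a complex variable with real coefficients. -/
def realEntireFunctions : Subring (ℂ → ℂ) where
  carrier := {f | ∃ a : ℕ → ℝ, ∀ z : ℂ, HasSum (fun n => (a n : ℂ) * z ^ n) (f z)}
  mul_mem' := by
    rintro f g ⟨a, ha⟩ ⟨b, hb⟩
    exact ⟨_, hasSum_real_mul ha hb⟩
  one_mem' := by
    refine ⟨fun n => if n = 0 then 1 else 0, fun z => ?_⟩
    have h : HasSum (fun n : ℕ => if n = 0 then (1 : ℂ) else 0) 1 := hasSum_ite_eq 0 1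
    have he : (fun n : ℕ => (((if n = 0 then 1 else 0 : ℝ)) : ℂ) * z ^ n) =
        fun n : ℕ => if n = 0 then (1 : ℂ) else 0 := by
      funext n
      split_ifs with hn <;> simp [hn]
    rw [he]
    exact h
  add_mem' := by
    rintro f g ⟨a, ha⟩ ⟨b, hb⟩
    refine ⟨fun n => a n + b n, fun z => ?_⟩
    have he : (fun n : ℕ => ((a n + b n : ℝ) : ℂ) * z ^ n) =
        fun n => (a n : ℂ) * z ^ n + (b n : ℂ) * z ^ n := by
      funext n
      push_cast
      ring
    rw [he]
    exact (ha z).add (hb z)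
  zero_mem' := ⟨fun _ => 0, fun z => by simp⟩
  neg_mem' := by
    rintro f ⟨a, ha⟩
    refine ⟨fun n => -a n, fun z => ?_⟩
    have he : (fun n : ℕ => ((-a n : ℝ) : ℂ) * z ^ n) = fun n => -((a n : ℂ) * z ^ n) := by
      funext n
      push_cast
      ring
    rw [he]
    exact (ha z).neg

theorem realEntireFunctions_le : realEntireFunctions ≤ analyticFunctions ℂ := by
  rintro f ⟨a, ha⟩
  let p : FormalMultilinearSeries ℂ ℂ ℂ := FormalMultilinearSeries.ofScalars ℂ fun n => (a n : ℂ)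
  have hp : HasFPowerSeriesOnBall f p 0 ⊤ := by
    refine ⟨?_, ENNReal.zero_lt_top, ?_⟩
    · refine le_of_forall_lt fun c hc => ?_
      obtain ⟨r, hcr, -⟩ := ENNReal.lt_iff_exists_nnreal_btwn.1 hc
      refine hcr.trans_le (p.le_radius_of_summable ?_)
      have h := (ha (r : ℝ)).summable.norm
      refine h.congr fun n => ?_
      simp [p]
    · intro y _
      simpa [p, FormalMultilinearSeries.ofScalars_apply_eq, mul_comm] using ha y
  intro z _
  exact hp.analyticAt_of_mem (by simp)

end DiscreteZ

open DiscreteZ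

namespace DiscreteZ

/-! ### Discrete `z`-ultrafilters and the topology of `θ𝕜`. -/

section General

variable {𝕜 : Type} [RCLike 𝕜]

/-! Two properties of the rings carry the proof: functions without a common zero are coprime, and
there are enough functions with prescribed zeros. If `f` is not in `M^p`, its zero set misses some
`Z` in `D^p`; a function vanishing on `Z` and sharing no zero with `f` lies in `M^p` and is coprime
to `f`, so `M^p` is maximal (`idealAt_isMaximal`). Conversely, the zero sets of a maximal ideal `M`
are nonempty and directed downwards, hence lie in some `D^p`; then `M ≤ M^p`, and maximality gives
equality (`exists_eq_idealAt`). The closure formula concerns only ultrafilters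
(`mem_closure_eta_image_iff`).

The analytic input is one convergent correction series, `exists_entire_corrections`. It yields the
Mittag-Leffler theorem, from which Bezout identities follow, and the Weierstrass theorem, from which
prescribed zeros and factorisations follow. Real coefficients are reached by averaging with the
conjugate function or by multiplying with it; on the real line `f² + g²` settles coprimality and
directedness.

With real coefficients only conjugation-invariant zero sets are visible. Since ultrafilters are
prime, these determine `D^p` up to conjugation (`idealAt_realEntire_eq_iff`). -/

theorem union_mem_closedDiscreteSets {Z W : Set 𝕜} (hZ : Z ∈ closedDiscreteSets 𝕜)
    (hW : W ∈ closedDiscreteSets 𝕜) : Z ∪ W ∈ closedDiscreteSets 𝕜 := by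
  rcases hZ with hZ | rfl
  · rcases hW with hW | rfl
    · exact Or.inl ⟨hZ.1.union hW.1, hZ.2.union hW.2 hZ.1 hW.1⟩
    · right; simp
  · right; simp

/-- The discrete `z`-filter generated by a family `B` of closed discrete sets that is directed
downwards. -/
theorem isDiscreteZFilter_of_directed {B : Set (Set 𝕜)} (he : ∅ ∉ B)
    (hB : ∀ X ∈ B, ∀ Y ∈ B, ∃ W ∈ B, W ⊆ X ∩ Y) :
    IsDiscreteZFilter {D | D ∈ closedDiscreteSets 𝕜 ∧ ∃ X ∈ B, X ⊆ D} where
  subset := fun _ h => h.1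
  empty_notMem := by
    rintro ⟨-, X, hX, hs⟩
    exact he (Set.subset_empty_iff.1 hs ▸ hX)
  inter_mem := by
    rintro D ⟨hD, X, hX, hXD⟩ E ⟨hE, Y, hY, hYE⟩
    obtain ⟨W, hW, hs⟩ := hB X hX Y hY
    exact ⟨inter_mem_closedDiscreteSets hD hE, W, hW, hs.trans (Set.inter_subset_inter hXD hYE)⟩
  mem_of_superset := by
    rintro D ⟨-, X, hX, hXD⟩ E hE hs
    exact ⟨hE, X, hX, hXD.trans hs⟩

/-- Every discrete `z`-filter is contained in a discrete `z`-ultrafilter. -/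
theorem IsDiscreteZFilter.exists_theta {F : Set (Set 𝕜)} (hF : IsDiscreteZFilter F) :
    ∃ p : Theta 𝕜, F ⊆ p.sets := by
  obtain ⟨m, hFm, hm⟩ := zorn_subset_nonempty {G : Set (Set 𝕜) | IsDiscreteZFilter G} (by
    intro c hc hchain hne
    refine ⟨⋃₀ c, ?_, fun s hs => Set.subset_sUnion_of_mem hs⟩
    exact
      { subset := Set.sUnion_subset fun G hG => (hc hG).subset
        empty_notMem := by
          rintro ⟨G, hG, h⟩
          exact (hc hG).empty_notMem h
        inter_mem := by
          rintro D ⟨G, hG, hD⟩ E ⟨H, hH, hE⟩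
          rcases hchain.total hG hH with h | h
          · exact ⟨H, hH, (hc hH).inter_mem _ (h hD) _ hE⟩
          · exact ⟨G, hG, (hc hG).inter_mem _ hD _ (h hE)⟩
        mem_of_superset := by
          rintro D ⟨G, hG, hD⟩ E hE hs
          exact ⟨G, hG, (hc hG).mem_of_superset _ hD _ hE hs⟩ }) F hF
  exact ⟨⟨m, hm.prop, fun G hG h => (hm.eq_of_subset hG h).symm⟩, hFm⟩

namespace Theta

theorem mem_of_superset (p : Theta 𝕜) {D E : Set 𝕜} (hD : D ∈ p.sets)
    (hE : E ∈ closedDiscreteSets 𝕜) (h : D ⊆ E) : E ∈ p.sets :=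
  p.isDiscreteZFilter.mem_of_superset D hD E hE h

theorem eq_of_subset {p q : Theta 𝕜} (h : p.sets ⊆ q.sets) : p = q :=
  Theta.ext (p.maximal _ q.isDiscreteZFilter h).symm

/-- Otherwise the traces `Z ∩ D` would generate a discrete `z`-filter containing both `D^p` and `D`,
against maximality. -/
theorem exists_disjoint (p : Theta 𝕜) {D : Set 𝕜} (hD : D ∈ closedDiscreteSets 𝕜)
    (h : D ∉ p.sets) : ∃ Z ∈ p.sets, Z ∩ D = ∅ := by
  by_contra! hne
  have hF := isDiscreteZFilter_of_directed (B := {X | ∃ Z ∈ p.sets, X = Z ∩ D}) (by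
    rintro ⟨Z, hZ, h⟩
    exact (hne Z hZ).ne_empty h.symm) (by
    rintro _ ⟨Z, hZ, rfl⟩ _ ⟨W, hW, rfl⟩
    refine ⟨_, ⟨Z ∩ W, p.isDiscreteZFilter.inter_mem _ hZ _ hW, rfl⟩, ?_⟩
    rintro x ⟨⟨h₁, h₂⟩, h₃⟩
    exact ⟨⟨h₁, h₃⟩, h₂, h₃⟩)
  have hmax := p.maximal _ hF fun Z hZ =>
    ⟨p.isDiscreteZFilter.subset hZ, _, ⟨Z, hZ, rfl⟩, Set.inter_subset_left⟩
  apply h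
  rw [← hmax]
  exact ⟨hD, _, ⟨_, univ_mem_sets p, rfl⟩, Set.inter_subset_right⟩

theorem mem_or_mem_of_union_mem (p : Theta 𝕜) {D E : Set 𝕜} (hD : D ∈ closedDiscreteSets 𝕜)
    (hE : E ∈ closedDiscreteSets 𝕜) (h : D ∪ E ∈ p.sets) : D ∈ p.sets ∨ E ∈ p.sets := by
  by_contra! hne
  obtain ⟨Z, hZ, hZD⟩ := p.exists_disjoint hD hne.1
  obtain ⟨W, hW, hWE⟩ := p.exists_disjoint hE hne.2
  have h' := p.isDiscreteZFilter.inter_mem _ (p.isDiscreteZFilter.inter_mem _ hZ _ hW) _ h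
  refine p.isDiscreteZFilter.empty_notMem ?_
  convert h'
  ext x
  have h₁ : x ∉ Z ∩ D := by simp [hZD]
  have h₂ : x ∉ W ∩ E := by simp [hWE]
  simp only [Set.mem_inter_iff, Set.mem_union, Set.mem_empty_iff_false] at *
  tauto

end Theta

/-- Primeness of ultrafilters turns a union of two basic closed sets into the basic closed set of
the union, so the generating family is already a base. -/
theorem isTopologicalBasis_compl_basicClosed : TopologicalSpace.IsTopologicalBasis
    {U : Set (Theta 𝕜) | ∃ Z : Set 𝕜, IsClosed Z ∧ IsDiscrete Z ∧ U = (basicClosed Z)ᶜ} where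
  exists_subset_inter := by
    rintro _ ⟨Z, hZ, hZ', rfl⟩ _ ⟨W, hW, hW', rfl⟩ p ⟨hpZ, hpW⟩
    have hZm : Z ∈ closedDiscreteSets 𝕜 := Or.inl ⟨hZ, hZ'⟩
    have hWm : W ∈ closedDiscreteSets 𝕜 := Or.inl ⟨hW, hW'⟩
    have hU := union_mem_closedDiscreteSets hZm hWm
    refine ⟨(basicClosed (Z ∪ W))ᶜ,
      ⟨Z ∪ W, hZ.union hW, hZ'.union hW' hZ hW, rfl⟩, ?_, ?_⟩
    · intro h
      rcases p.mem_or_mem_of_union_mem hZm hWm h with h | h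
      exacts [hpZ h, hpW h]
    · exact fun q hq => ⟨fun h => hq (q.mem_of_superset h hU Set.subset_union_left),
        fun h => hq (q.mem_of_superset h hU Set.subset_union_right)⟩
  sUnion_eq := by
    refine Set.eq_univ_of_forall fun p => ⟨_, ⟨∅, isClosed_empty,
      Set.subsingleton_empty.isDiscrete, rfl⟩, p.isDiscreteZFilter.empty_notMem⟩
  eq_generateFrom := rfl

/-- If `D` is in `D^p` and `Z` is not, then `D` has a point outside `Z`, whose fixed ultrafilter
lies in the basic neighbourhood given by `Z`. If `D` is not in `D^p`, the complement of `basicClosed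
D` separates `p` from all of `eta '' D`. -/
theorem mem_closure_eta_image_iff (p : Theta 𝕜) {D : Set 𝕜} (hD : D ∈ closedDiscreteSets 𝕜) :
    p ∈ closure (eta '' D) ↔ D ∈ p.sets := by
  rw [isTopologicalBasis_compl_basicClosed.mem_closure_iff]
  constructor
  · intro h
    rcases hD with ⟨hc, hd⟩ | rfl
    · by_contra hp
      obtain ⟨_, hq, x, hx, rfl⟩ := h _ ⟨D, hc, hd, rfl⟩ hp
      exact hq ⟨Or.inl ⟨hc, hd⟩, hx⟩
    · exact univ_mem_sets p
  · rintro hp _ ⟨Z, hZ, hZ', rfl⟩ hpZ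
    have hns : ¬ D ⊆ Z := fun h => hpZ (p.mem_of_superset hp (Or.inl ⟨hZ, hZ'⟩) h)
    obtain ⟨x, hx, hxZ⟩ := Set.not_subset.1 hns
    exact ⟨eta x, fun h : Z ∈ (eta x).sets => hxZ h.2, x, hx, rfl⟩

/-! ### Maximal ideals and ultrafilters for a general ring of analytic functions. -/

section Ideals

variable {A : Subring (𝕜 → 𝕜)} (hA : A ≤ analyticFunctions 𝕜)

theorem zeroSet_mem (hA : A ≤ analyticFunctions 𝕜) (f : A) : zeroSet (f : 𝕜 → 𝕜) ∈ closedDiscreteSets 𝕜 :=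
  zeroSet_mem_closedDiscreteSets (hA f.2)

theorem mem_idealAt {p : Theta 𝕜} {f : A} :
    f ∈ idealAt A hA p ↔ zeroSet (f : 𝕜 → 𝕜) ∈ p.sets := Iff.rfl

theorem idealAt_eq_closure (p : Theta 𝕜) :
    (idealAt A hA p : Set A) = {f : A | p ∈ closure (eta '' zeroSet (f : 𝕜 → 𝕜))} := by
  ext f
  exact (mem_closure_eta_image_iff p (zeroSet_mem hA f)).symm

theorem idealAt_ne_top (p : Theta 𝕜) : idealAt A hA p ≠ ⊤ := by
  rw [Ideal.ne_top_iff_one, mem_idealAt]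
  have h : zeroSet ((1 : A) : 𝕜 → 𝕜) = ∅ := by ext x; simp [zeroSet]
  rw [h]
  exact p.isDiscreteZFilter.empty_notMem

/-- The hypothesis `hsep` asks only for a zero set containing `Z`, because with real coefficients
`Z` itself need not be one. -/
theorem idealAt_isMaximal
    (hcop : ∀ f g : A, zeroSet (f : 𝕜 → 𝕜) ∩ zeroSet (g : 𝕜 → 𝕜) = ∅ → IsCoprime f g)
    (hsep : ∀ Z : Set 𝕜, IsClosed Z → IsDiscrete Z → ∀ f : A, Z ∩ zeroSet (f : 𝕜 → 𝕜) = ∅ →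
      ∃ g : A, Z ⊆ zeroSet (g : 𝕜 → 𝕜) ∧ zeroSet (g : 𝕜 → 𝕜) ∩ zeroSet (f : 𝕜 → 𝕜) = ∅)
    (p : Theta 𝕜) : (idealAt A hA p).IsMaximal := by
  rw [Ideal.isMaximal_iff]
  refine ⟨(Ideal.ne_top_iff_one _).1 (idealAt_ne_top hA p), fun J f hJ hf hfJ => ?_⟩
  obtain ⟨Z, hZ, hZf⟩ := p.exists_disjoint (zeroSet_mem hA f) hf
  obtain ⟨g, hg, hgf⟩ : ∃ g : A, Z ⊆ zeroSet (g : 𝕜 → 𝕜) ∧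
      zeroSet (g : 𝕜 → 𝕜) ∩ zeroSet (f : 𝕜 → 𝕜) = ∅ := by
    rcases p.isDiscreteZFilter.subset hZ with ⟨hc, hd⟩ | rfl
    · exact hsep Z hc hd f hZf
    -- Here `Z` is the whole field, so `f` has no zeros and the zero function already works.
    · exact ⟨0, fun x _ => by simp [zeroSet], by simpa [zeroSet] using hZf⟩
  obtain ⟨a, b, hab⟩ := hcop g f hgf
  rw [← hab]
  exact J.add_mem (J.mul_mem_left _ (hJ (p.mem_of_superset hZ (zeroSet_mem hA g) hg)))
    (J.mul_mem_left _ hfJ)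

/-- Directedness comes from `hsplit` and primeness of `M`: one of `F`, `G` lies in `M`, and it
cannot be `G`, which has no zero in common with `g`. No greatest common divisor is needed. -/
theorem exists_eq_idealAt
    (hcop : ∀ f g : A, zeroSet (f : 𝕜 → 𝕜) ∩ zeroSet (g : 𝕜 → 𝕜) = ∅ → IsCoprime f g)
    (hsplit : ∀ f g : A, ∃ F G : A, F * G ∈ Ideal.span {f, g} ∧
      zeroSet (F : 𝕜 → 𝕜) ⊆ zeroSet (f : 𝕜 → 𝕜) ∩ zeroSet (g : 𝕜 → 𝕜) ∧
      zeroSet (G : 𝕜 → 𝕜) ∩ zeroSet (g : 𝕜 → 𝕜) = ∅)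
    {M : Ideal A} (hM : M.IsMaximal) :
    ∃ p : Theta 𝕜, M = idealAt A hA p := by
  have hdisj : ∀ f ∈ M, ∀ g ∈ M, zeroSet (f : 𝕜 → 𝕜) ∩ zeroSet (g : 𝕜 → 𝕜) ≠ ∅ := by
    intro f hf g hg h
    obtain ⟨a, b, hab⟩ := hcop f g h
    refine (Ideal.ne_top_iff_one M).1 hM.ne_top ?_
    rw [← hab]
    exact M.add_mem (M.mul_mem_left _ hf) (M.mul_mem_left _ hg)
  have hF := isDiscreteZFilter_of_directed (B := zeroSets M) (by
    rintro ⟨f, hf, h⟩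
    exact hdisj f hf f hf (by rw [← h, Set.inter_self])) (by
    rintro _ ⟨f, hf, rfl⟩ _ ⟨g, hg, rfl⟩
    obtain ⟨F, G, hFG, hF, hG⟩ := hsplit f g
    have hle : Ideal.span {f, g} ≤ M := Ideal.span_le.2 (by
      rintro _ (rfl | rfl)
      exacts [hf, hg])
    rcases hM.isPrime.mem_or_mem (hle hFG) with h | h
    · exact ⟨_, ⟨F, h, rfl⟩, hF⟩
    · exact absurd hG (hdisj G h g hg))
  obtain ⟨p, hp⟩ := hF.exists_theta
  exact ⟨p, hM.eq_of_le (idealAt_ne_top hA p) fun f hf =>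
    hp ⟨zeroSet_mem hA f, _, ⟨f, hf, rfl⟩, subset_rfl⟩⟩

theorem zeroSets_idealAt_subset (p : Theta 𝕜) : zeroSets (idealAt A hA p) ⊆ p.sets := by
  rintro _ ⟨f, hf, rfl⟩
  exact hf

theorem zeroSets_idealAt
    (hzero : ∀ Z : Set 𝕜, IsClosed Z → IsDiscrete Z → ∃ f : A, zeroSet (f : 𝕜 → 𝕜) = Z)
    (p : Theta 𝕜) : zeroSets (idealAt A hA p) = p.sets := by
  refine (zeroSets_idealAt_subset hA p).antisymm fun Z hZ => ?_
  obtain ⟨f, rfl⟩ : ∃ f : A, zeroSet (f : 𝕜 → 𝕜) = Z := by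
    rcases p.isDiscreteZFilter.subset hZ with ⟨hc, hd⟩ | rfl
    · exact hzero Z hc hd
    · exact ⟨0, by simp [zeroSet]⟩
  exact ⟨f, hZ, rfl⟩

end Ideals

end General

end DiscreteZ

namespace DiscreteZ

/-! ### The Mittag-Leffler and Weierstrass theorems. -/

section Entire

open Metric Set Filter Topology

theorem exists_entire_approx {ψ : ℂ → ℂ} {r : ℝ} (hψ : DifferentiableOn ℂ ψ (ball 0 r)) {ε : ℝ}
    (hε : 0 < ε) : ∃ q : ℂ → ℂ, Differentiable ℂ q ∧ ∀ z ∈ ball (0 : ℂ) (r / 2), ‖ψ z - q z‖ ≤ ε := by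
  rcases le_or_gt r 0 with hr | hr
  · refine ⟨0, differentiable_const 0, fun z hz => ?_⟩
    rw [ball_eq_empty.2 (by linarith)] at hz
    exact hz.elim
  · lift r to NNReal using hr.le
    have hr' : 0 < r := hr
    -- The intermediate radius `3r/4` keeps the closed disc inside the domain, while Taylor sums
    -- still converge uniformly on the ball of radius `r/2`.
    have h1 : DifferentiableOn ℂ ψ (closedBall 0 ((r * (3 / 4) : NNReal) : ℝ)) :=
      hψ.mono (closedBall_subset_ball (by push_cast; linarith))
    have h2 := h1.hasFPowerSeriesOnBall (by positivity)
    have h3 := h2.tendstoUniformlyOn (r' := r / 2) (by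
      rw [ENNReal.coe_lt_coe, ← NNReal.coe_lt_coe]
      push_cast
      linarith)
    obtain ⟨n, hn⟩ := (Metric.tendstoUniformlyOn_iff.1 h3 ε hε).exists
    refine ⟨(cauchyPowerSeries ψ 0 ((r * (3 / 4) : NNReal) : ℝ)).partialSum n, ?_, fun z hz => ?_⟩
    rotate_left
    · have := (hn z (by simpa using hz)).le
      rwa [dist_eq_norm, zero_add] at this
    · unfold FormalMultilinearSeries.partialSum
      have : ∀ i : ℕ, Differentiable ℂ fun x : ℂ =>
          (cauchyPowerSeries ψ 0 ((r * (3 / 4) : NNReal) : ℝ) i) fun _ => x := by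
        intro i
        simp
      fun_prop

/-- The correction terms that make a series over a closed discrete set converge: outside a finite set
of indices, the corrected series is analytic on a given ball. -/
theorem exists_entire_corrections {S : Set ℂ} (hc : IsClosed S) (hd : IsDiscrete S)
    (ψ : S → ℂ → ℂ) (hψ : ∀ a, DifferentiableOn ℂ (ψ a) (ball 0 ‖(a : ℂ)‖)) :
    ∃ q : S → ℂ → ℂ, (∀ a, Differentiable ℂ (q a)) ∧ ∀ R : ℝ, ∃ T : Finset S,
      (∀ a ∉ T, 2 * R ≤ ‖(a : ℂ)‖) ∧
      (∀ z ∈ ball (0 : ℂ) R, Summable fun a : ↥((T : Set S)ᶜ) => ψ a z - q a z) ∧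
      DifferentiableOn ℂ (fun z => ∑' a : ↥((T : Set S)ᶜ), (ψ a z - q a z)) (ball 0 R) := by
  have := hd.to_subtype
  have : Countable S := countable_of_Lindelof_of_discrete
  have := Encodable.ofCountable S
  obtain ⟨u, hu, c, huc, -⟩ := posSumOfEncodable one_pos S
  choose q hq hqu using fun a => exists_entire_approx (hψ a) (hu a)
  refine ⟨q, hq, fun R => ?_⟩
  -- Only these finitely many indices are set aside: for all others the ball of radius `R` lies in
  -- that of radius `‖a‖/2`, where the error is at most `u a`.
  have hfin : {a : S | ‖(a : ℂ)‖ < 2 * R}.Finite := by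
    have h : (closedBall (0 : ℂ) (2 * R) ∩ S).Finite :=
      ((isCompact_closedBall _ _).inter_right hc).finite (hd.mono inter_subset_right)
    refine Set.Finite.of_finite_image (f := Subtype.val) (h.subset ?_) Subtype.val_injective.injOn
    rintro _ ⟨a, ha, rfl⟩
    exact ⟨by simpa using (show ‖(a : ℂ)‖ < 2 * R from ha).le, a.2⟩
  have hT : ∀ a : S, a ∉ hfin.toFinset → 2 * R ≤ ‖(a : ℂ)‖ := fun a ha => by
    simpa using ha
  have hbd : ∀ a : ↥((hfin.toFinset : Set S)ᶜ), ∀ z ∈ ball (0 : ℂ) R,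
      ‖ψ a z - q a z‖ ≤ u a := fun a z hz => by
    refine hqu a z (ball_subset_ball ?_ hz)
    linarith [hT a a.2]
  have hus : Summable fun a : ↥((hfin.toFinset : Set S)ᶜ) => u a :=
    huc.summable.comp_injective Subtype.val_injective
  refine ⟨hfin.toFinset, hT, fun z hz => ?_, ?_⟩
  · exact Summable.of_norm_bounded hus fun a => hbd a z hz
  · refine Complex.differentiableOn_tsum_of_summable_norm hus (fun a => ?_) isOpen_ball hbd
    refine DifferentiableOn.sub ((hψ a).mono (ball_subset_ball ?_)) (hq a).differentiableOn
    rcases le_or_gt R 0 with hR | hR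
    · exact hR.trans (norm_nonneg _)
    · linarith [hT a a.2]

/-- **Mittag-Leffler theorem** for the plane. -/
theorem exists_mittagLeffler {S : Set ℂ} (hc : IsClosed S) (hd : IsDiscrete S)
    (P : ℂ → ℂ → ℂ) (hP : ∀ a ∈ S, ∀ z, z ≠ a → AnalyticAt ℂ (P a) z) :
    ∃ A : ℂ → ℂ, (∀ z ∉ S, AnalyticAt ℂ A z) ∧ ∀ a ∈ S, AnalyticAt ℂ (fun z => A z - P a z) a := by
  obtain ⟨q, hq, hT⟩ := exists_entire_corrections hc hd (fun a => P a) (fun a z hz =>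
    (hP a a.2 z (by rintro rfl; simp at hz)).differentiableAt.differentiableWithinAt)
  -- Near each point the series is a finite sum plus an analytic function, and the finite sum
  -- includes any term with its pole there.
  have key : ∀ z₀ : ℂ, ∃ T : Finset S, (∀ a : S, (a : ℂ) = z₀ → a ∈ T) ∧ ∃ G : ℂ → ℂ,
      AnalyticAt ℂ G z₀ ∧ (fun z => ∑' a : S, (P a z - q a z)) =ᶠ[𝓝 z₀]
        fun z => ∑ a ∈ T, (P a z - q a z) + G z := by
    intro z₀
    obtain ⟨T, hTR, hs, hD⟩ := hT (‖z₀‖ + 1)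
    have hmem : ball (0 : ℂ) (‖z₀‖ + 1) ∈ 𝓝 z₀ := isOpen_ball.mem_nhds (by simp)
    refine ⟨T, fun a ha => ?_, _, hD.analyticAt hmem, ?_⟩
    · by_contra h
      have := hTR a h
      rw [ha] at this
      linarith [norm_nonneg z₀]
    · filter_upwards [hmem] with z hz
      have hsz : Summable fun a : S => P a z - q a z := (Finset.summable_compl_iff T).1 (hs z hz)
      exact hsz.sum_add_tsum_compl.symm
  have hqa : ∀ a z, AnalyticAt ℂ (q a) z := fun a z => (hq a).analyticAt z
  refine ⟨fun z => ∑' a : S, (P a z - q a z), fun z hz => ?_, fun a ha => ?_⟩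
  · obtain ⟨T, -, G, hG, heq⟩ := key z
    refine AnalyticAt.congr ?_ heq.symm
    refine AnalyticAt.add (Finset.analyticAt_fun_sum T fun a _ => ?_) hG
    exact (hP a a.2 z (by rintro rfl; exact hz a.2)).sub (hqa a z)
  · obtain ⟨T, hT, G, hG, heq⟩ := key a
    have haT := hT ⟨a, ha⟩ rfl
    have h1 : AnalyticAt ℂ (fun z => ∑ b ∈ T.erase ⟨a, ha⟩, (P b z - q b z) - q ⟨a, ha⟩ z + G z) a := by
      refine AnalyticAt.add (AnalyticAt.sub (Finset.analyticAt_fun_sum _ fun b hb => ?_) (hqa _ a)) hG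
      refine (hP b b.2 a ?_).sub (hqa b a)
      rintro rfl
      simp at hb
    refine h1.congr ?_
    filter_upwards [heq] with z hz
    rw [hz, ← Finset.sum_erase_add _ _ haT]
    ring

/-- **Weierstrass product theorem** for the plane. -/
theorem exists_entire_analyticOrderAt_eq (m : ℂ → ℕ) (hc : IsClosed m.support)
    (hd : IsDiscrete m.support) :
    ∃ F : ℂ → ℂ, Differentiable ℂ F ∧ ∀ z, analyticOrderAt F z = m z := by
  -- The series is applied to `m a` times a logarithm of `(1 - z/a)(-a) = z - a`, which is analytic
  -- for `‖z‖ < ‖a‖`. If `a = 0` this ball is empty and nothing is required.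
  obtain ⟨q, hq, hT⟩ := exists_entire_corrections hc hd
    (fun a z => m a * (Complex.log (1 - z / a) + Complex.log (-a))) (fun a z hz => by
      have ha : (a : ℂ) ≠ 0 := by rintro h; simp [h] at hz
      have h1 : 1 - z / a ∈ Complex.slitPlane := by
        rw [sub_eq_add_neg]
        apply Complex.mem_slitPlane_of_norm_lt_one
        rw [norm_neg, norm_div, div_lt_one (norm_pos_iff.2 ha)]
        simpa using hz
      refine DifferentiableAt.differentiableWithinAt ?_
      refine DifferentiableAt.const_mul (DifferentiableAt.add_const _ ?_) _
      exact DifferentiableAt.clog (by fun_prop) h1)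
  set e : m.support → ℂ → ℂ := fun a z => (z - a) ^ m a * Complex.exp (-q a z) with he
  have key : ∀ z₀ : ℂ, ∃ T : Finset m.support, (∀ a : m.support, (a : ℂ) = z₀ → a ∈ T) ∧
      ∃ G : ℂ → ℂ, AnalyticAt ℂ G z₀ ∧ (fun z => ∏' a : m.support, e a z) =ᶠ[𝓝 z₀]
        (∏ a ∈ T, e a) * fun z => Complex.exp (G z) := by
    intro z₀
    obtain ⟨T, hTR, hs, hD⟩ := hT (‖z₀‖ + 1)
    have hmem : ball (0 : ℂ) (‖z₀‖ + 1) ∈ 𝓝 z₀ := isOpen_ball.mem_nhds (by simp)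
    refine ⟨T, fun a ha => ?_, _, hD.analyticAt hmem, ?_⟩
    · by_contra h
      have := hTR a h
      rw [ha] at this
      linarith [norm_nonneg z₀]
    · filter_upwards [hmem] with z hz
      have h1 := (hs z hz).hasSum.cexp
      -- Exponentiating the corrected logarithms gives back the factors `e a`, so summability of the
      -- tail makes the product converge to a zero-free analytic function.
      have h2 : (Complex.exp ∘ fun a : ↥((T : Set m.support)ᶜ) =>
          m a * (Complex.log (1 - z / a) + Complex.log (-a)) - q a z) =
          (fun a => e a z) ∘ Subtype.val := by
        funext a
        have hza : ‖z‖ < ‖(a : ℂ)‖ := by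
          have := hTR a a.2
          have hz' : ‖z‖ < ‖z₀‖ + 1 := by simpa using hz
          linarith [norm_nonneg z₀]
        have ha : ((a : m.support) : ℂ) ≠ 0 := norm_pos_iff.1 ((norm_nonneg z).trans_lt hza)
        have h1 : 1 - z / (a : m.support) ≠ 0 := by
          intro h
          have : z = (a : m.support) := by
            field_simp at h
            linear_combination -h
          rw [this] at hza
          exact lt_irrefl _ hza
        simp only [Function.comp, he, sub_eq_add_neg (_ * _), Complex.exp_add, Complex.exp_nat_mul]
        rw [Complex.exp_log h1, Complex.exp_log (neg_ne_zero.2 ha)]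
        congr 2
        field_simp
        ring
      rw [h2] at h1
      have h3 := HasProd.mul_isCompl isCompl_compl (T.hasProd fun a => e a z) h1
      simpa using h3.tprod_eq
  have hea : ∀ a z, AnalyticAt ℂ (e a) z := fun a z => by
    have := (hq a).analyticAt z
    fun_prop
  have hF : ∀ z₀, AnalyticAt ℂ (fun z => ∏' a : m.support, e a z) z₀ := fun z₀ => by
    obtain ⟨T, -, G, hG, heq⟩ := key z₀
    exact ((T.analyticAt_prod fun a _ => hea a z₀).mul hG.cexp).congr heq.symm
  refine ⟨_, fun z => (hF z).differentiableAt, fun z₀ => ?_⟩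
  obtain ⟨T, hTm, G, hG, heq⟩ := key z₀
  have hexp : AnalyticAt ℂ (fun z => Complex.exp (G z)) z₀ := hG.cexp
  rw [analyticOrderAt_congr heq, analyticOrderAt_mul (T.analyticAt_prod fun a _ => hea a z₀) hexp,
    hexp.analyticOrderAt_eq_zero.2 (Complex.exp_ne_zero _), add_zero]
  have hord : ∀ a, analyticOrderAt (e a) z₀ = if (a : ℂ) = z₀ then (m z₀ : ℕ∞) else 0 := by
    intro a
    split_ifs with h
    · rw [(hea a z₀).analyticOrderAt_eq_natCast]
      refine ⟨fun z => Complex.exp (-q a z), ?_, Complex.exp_ne_zero _, ?_⟩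
      · have := (hq a).analyticAt z₀
        fun_prop
      · simp [he, h]
    · rw [(hea a z₀).analyticOrderAt_eq_zero]
      simp [he, sub_ne_zero, Ne.symm h]
  have hprod : ∀ T : Finset m.support,
      analyticOrderAt (∏ a ∈ T, e a) z₀ = ∑ a ∈ T, if (a : ℂ) = z₀ then (m z₀ : ℕ∞) else 0 := by
    intro T
    induction T using Finset.induction_on with
    | empty =>
      have : AnalyticAt ℂ (1 : ℂ → ℂ) z₀ := analyticAt_const
      simpa using this.analyticOrderAt_eq_zero.2 (by simp)
    | insert a T ha ih =>
      rw [Finset.prod_insert ha, Finset.sum_insert ha,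
        analyticOrderAt_mul (hea a z₀) (T.analyticAt_prod fun a _ => hea a z₀), ih, hord]
  rw [hprod]
  by_cases hz : m z₀ = 0
  · simp [hz]
  · rw [Finset.sum_eq_single_of_mem ⟨z₀, hz⟩ (hTm _ rfl)]
    · simp
    · intro b _ hb
      rw [if_neg]
      rintro rfl
      exact hb rfl

end Entire

end DiscreteZ

namespace DiscreteZ

/-! ### Bezout identities and factorisations for entire functions. -/

section Entire

open Metric Set Filter Topology ComplexConjugate

theorem eventuallyEq_nhds_of_nhdsNE {f g : ℂ → ℂ} {a : ℂ} (h : ∀ᶠ z in 𝓝[≠] a, f z = g z)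
    (ha : f a = g a) : f =ᶠ[𝓝 a] g := by
  rw [eventually_nhdsWithin_iff] at h
  filter_upwards [h] with z hz
  by_cases hza : z = a
  · rw [hza, ha]
  · exact hz hza

/-- Multiply by `(z - a)^n` to remove the pole and expand to order `n`: the Taylor polynomial
divided by `(z - a)^n` is `P`, and the remainder gives `B`. -/
theorem exists_principalPart {h : ℂ → ℂ} {a : ℂ} (hh : MeromorphicAt h a) :
    ∃ P : ℂ → ℂ, (∀ z, z ≠ a → AnalyticAt ℂ P z) ∧
      ∃ B : ℂ → ℂ, AnalyticAt ℂ B a ∧ ∀ᶠ z in 𝓝[≠] a, h z - P z = B z := by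
  obtain ⟨n, hn⟩ := hh
  have h0 : AnalyticAt ℂ (fun w => w ^ n * h (w + a)) 0 := by
    have h2 : AnalyticAt ℂ (fun w : ℂ => w + a) 0 := by fun_prop
    simpa using AnalyticAt.fun_comp_of_eq hn h2 (zero_add a)
  obtain ⟨F, hF, heq⟩ := h0.exists_eq_sum_add_pow_mul n
  refine ⟨fun z => (∑ i ∈ .range n, ((z - a) ^ i / i.factorial) •
    iteratedDeriv i (fun w => w ^ n * h (w + a)) 0) / (z - a) ^ n, fun z hz => ?_,
    fun z => F (z - a), ?_, ?_⟩
  · refine AnalyticAt.div (Finset.analyticAt_fun_sum _ fun i _ => ?_) (by fun_prop)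
      (pow_ne_zero _ (sub_ne_zero.2 hz))
    have : (i.factorial : ℂ) ≠ 0 := by exact_mod_cast i.factorial_ne_zero
    fun_prop (disch := assumption)
  · have h1 : AnalyticAt ℂ F (a - a) := by simpa using hF
    have h2 : AnalyticAt ℂ (fun w : ℂ => w - a) a := by fun_prop
    exact AnalyticAt.fun_comp h1 h2
  · filter_upwards [self_mem_nhdsWithin] with z hz
    have hz' : (z - a) ^ n ≠ 0 := pow_ne_zero _ (sub_ne_zero.2 hz)
    have := heq (z - a)
    simp only [sub_add_cancel, smul_eq_mul] at this ⊢
    rw [sub_eq_iff_eq_add, eq_comm, ← mul_right_inj' hz', this]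
    field_simp
    ring

theorem eventually_nhdsNE_notMem {S : Set ℂ} (hc : IsClosed S) (hd : IsDiscrete S) (a : ℂ) :
    ∀ᶠ z in 𝓝[≠] a, z ∉ S := by
  have := isClosed_and_discrete_iff.1 ⟨hc, hd⟩ a
  rwa [disjoint_principal_right] at this

theorem zeroSet_isClosed_and_isDiscrete {f : ℂ → ℂ} (hf : Differentiable ℂ f) (h : ∃ z, f z ≠ 0) :
    IsClosed (zeroSet f) ∧ IsDiscrete (zeroSet f) := by
  rcases zeroSet_mem_closedDiscreteSets (f := f) fun z _ => hf.analyticAt z with h' | h'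
  · exact h'
  · obtain ⟨z, hz⟩ := h
    have : z ∈ zeroSet f := h' ▸ mem_univ z
    exact absurd this hz

/-- Entire functions without common zeros generate the unit ideal. -/
theorem exists_bezout_entire {f g : ℂ → ℂ} (hf : Differentiable ℂ f) (hg : Differentiable ℂ g)
    (h : zeroSet f ∩ zeroSet g = ∅) :
    ∃ u v : ℂ → ℂ, Differentiable ℂ u ∧ Differentiable ℂ v ∧ ∀ z, u z * f z + v z * g z = 1 := by
  have hfg : ∀ z, g z = 0 → f z ≠ 0 := fun z hz hz' => by
    have : z ∈ zeroSet f ∩ zeroSet g := ⟨hz', hz⟩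
    simp [h] at this
  by_cases hg0 : ∃ z, g z ≠ 0
  swap
  · push Not at hg0
    exact ⟨fun z => (f z)⁻¹, 0, fun z => (hf z).inv (hfg z (hg0 z)), differentiable_const 0,
      fun z => by simp [hfg z (hg0 z)]⟩
  obtain ⟨hc, hd⟩ := zeroSet_isClosed_and_isDiscrete hg hg0
  have hfa : ∀ z, AnalyticAt ℂ f z := fun z => hf.analyticAt z
  have hga : ∀ z, AnalyticAt ℂ g z := fun z => hg.analyticAt z
  choose P hP B hB hPB using fun a => exists_principalPart (h := fun z => (f z * g z)⁻¹) (a := a)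
    ((hfa a).mul (hga a)).meromorphicAt.inv
  -- `A` has the principal parts of `1/(fg)` at the zeros of `g`. Thus `A = 1/(fg) - E` near such a
  -- zero, with `E` analytic.
  obtain ⟨A, hA, hAP⟩ := exists_mittagLeffler hc hd P fun a _ => hP a
  have hE : ∀ a, g a = 0 → ∃ E : ℂ → ℂ, AnalyticAt ℂ E a ∧
      ∀ᶠ z in 𝓝[≠] a, f z ≠ 0 ∧ g z ≠ 0 ∧ A z = (f z * g z)⁻¹ - E z := by
    intro a ha
    refine ⟨fun z => B a z - (A z - P a z), (hB a).sub (hAP a ha), ?_⟩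
    filter_upwards [hPB a, eventually_nhdsNE_notMem hc hd a,
      ((hfa a).continuousAt.eventually_ne (hfg a ha)).filter_mono nhdsWithin_le_nhds] with z h1 h2 h3
    refine ⟨h3, h2, ?_⟩
    rw [← h1]
    ring
  choose! E hEa hE using hE
  classical
  -- The solution is `u = gA`, `v = (1 - uf)/g`. Near a zero of `g` these equal `1/f - gE` and `fE`,
  -- which dictates the values filled in.
  set u : ℂ → ℂ := fun z => if g z = 0 then (f z)⁻¹ else g z * A z with hu
  set v : ℂ → ℂ := fun z => if g z = 0 then f z * E z z else (1 - u z * f z) / g z with hv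
  have hua : ∀ z, AnalyticAt ℂ u z := by
    intro a
    by_cases ha : g a = 0
    · have h1 : AnalyticAt ℂ (fun z => (f z)⁻¹ - g z * E a z) a :=
        ((hfa a).inv (hfg a ha)).sub ((hga a).mul (hEa a ha))
      refine h1.congr (eventuallyEq_nhds_of_nhdsNE ?_ ?_)
      · filter_upwards [hE a ha] with z ⟨h1, h2, h3⟩
        simp only [hu, if_neg h2, h3]
        field_simp
      · simp [hu, ha]
    · refine ((hga a).mul (hA a ha)).congr ?_
      filter_upwards [(hga a).continuousAt.eventually_ne ha] with z hz
      simp [hu, hz]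
  have hva : ∀ z, AnalyticAt ℂ v z := by
    intro a
    by_cases ha : g a = 0
    · refine ((hfa a).mul (hEa a ha)).congr (eventuallyEq_nhds_of_nhdsNE ?_ ?_)
      · filter_upwards [hE a ha] with z ⟨h1, h2, h3⟩
        simp only [hu, hv, if_neg h2, h3, Pi.mul_apply]
        field_simp
        ring
      · simp [hv, ha]
    · have h1 : AnalyticAt ℂ (fun z => (1 - u z * f z) / g z) a :=
        (analyticAt_const.sub ((hua a).mul (hfa a))).div (hga a) ha
      refine h1.congr ?_
      filter_upwards [(hga a).continuousAt.eventually_ne ha] with z hz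
      simp [hv, hz]
  refine ⟨u, v, fun z => (hua z).differentiableAt, fun z => (hva z).differentiableAt, fun z => ?_⟩
  by_cases hz : g z = 0
  · simp [hu, hz, hfg z hz]
  · simp only [hv, if_neg hz]
    field_simp
    ring

/-- An entire function is divisible by one whose zeros have no larger order. -/
theorem exists_entire_mul_eq {f F : ℂ → ℂ} (hf : Differentiable ℂ f) (hF : Differentiable ℂ F)
    (hF0 : ∀ z, analyticOrderAt F z ≠ ⊤) (hle : ∀ z, analyticOrderAt F z ≤ analyticOrderAt f z) :
    ∃ G : ℂ → ℂ, Differentiable ℂ G ∧ ∀ z, f z = F z * G z := by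
  have hloc : ∀ a, ∃ H : ℂ → ℂ, AnalyticAt ℂ H a ∧
      (∀ᶠ z in 𝓝[≠] a, F z ≠ 0) ∧ ∀ᶠ z in 𝓝 a, f z = F z * H z := by
    intro a
    obtain ⟨n, hn⟩ := ENat.ne_top_iff_exists.1 (hF0 a)
    obtain ⟨H, hH, hHa, hFH⟩ := (hF.analyticAt a).analyticOrderAt_eq_natCast.1 hn.symm
    obtain ⟨K, hK, hfK⟩ := (natCast_le_analyticOrderAt (hf.analyticAt a)).1 (hn ▸ hle a)
    have hH0 := hH.continuousAt.eventually_ne hHa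
    refine ⟨fun z => K z / H z, hK.div hH hHa, ?_, ?_⟩
    · filter_upwards [hFH.filter_mono nhdsWithin_le_nhds, hH0.filter_mono nhdsWithin_le_nhds,
        self_mem_nhdsWithin] with z h1 h2 h3
      rw [h1]
      exact smul_ne_zero (pow_ne_zero _ (sub_ne_zero.2 h3)) h2
    · filter_upwards [hFH, hfK, hH0] with z h1 h2 h3
      rw [h1, h2, smul_eq_mul, smul_eq_mul]
      field_simp
  choose H hH hFne hfH using hloc
  -- The local quotients agree wherever `F` is nonzero, so the diagonal `z ↦ H z z` coincides near
  -- `a` with the analytic function `H a`.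
  have hG : ∀ a, (fun z => H z z) =ᶠ[𝓝 a] H a := by
    intro a
    refine eventuallyEq_nhds_of_nhdsNE ?_ rfl
    filter_upwards [hFne a, (hfH a).filter_mono nhdsWithin_le_nhds] with z h1 h2
    exact mul_left_cancel₀ h1 ((hfH z).self_of_nhds.symm.trans h2)
  exact ⟨fun z => H z z, fun a => ((hH a).congr (hG a).symm).differentiableAt,
    fun z => (hfH z).self_of_nhds⟩

/-- An entire function factors along a splitting of its zero set. -/
theorem exists_entire_split {f : ℂ → ℂ} (hf : Differentiable ℂ f) (h0 : ∃ z, f z ≠ 0) {S : Set ℂ}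
    (hc : IsClosed S) (hS : S ⊆ zeroSet f) :
    ∃ F G : ℂ → ℂ, Differentiable ℂ F ∧ Differentiable ℂ G ∧ (∀ z, f z = F z * G z) ∧
      zeroSet F = S ∧ zeroSet G ∩ S = ∅ := by
  have hfa : AnalyticOnNhd ℂ f univ := fun z _ => hf.analyticAt z
  have htop : ∀ z, analyticOrderAt f z ≠ ⊤ := by
    obtain ⟨w, hw⟩ := h0
    intro z
    refine hfa.analyticOrderAt_ne_top_of_isPreconnected isPreconnected_univ (mem_univ w)
      (mem_univ z) ?_
    rw [(hf.analyticAt w).analyticOrderAt_eq_zero.2 hw]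
    exact ENat.zero_ne_top
  classical
  -- `F` takes the full multiplicity of `f` on `S`, so that none is left for `G` there.
  set m : ℂ → ℕ := fun z => if z ∈ S then analyticOrderNatAt f z else 0 with hm
  have hmS : ∀ z ∈ S, (m z : ℕ∞) = analyticOrderAt f z := fun z hz => by
    simp only [hm, if_pos hz, Nat.cast_analyticOrderNatAt (htop z)]
  have hm0 : ∀ z, m z ≠ 0 ↔ z ∈ S := by
    intro z
    by_cases hz : z ∈ S
    · have : (m z : ℕ∞) ≠ 0 := by
        rw [hmS z hz, (hf.analyticAt z).analyticOrderAt_ne_zero]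
        exact hS hz
      simpa [hz] using this
    · simp [hm, hz]
  have hsupp : m.support = S := Set.ext hm0
  obtain ⟨F, hF, hFo⟩ := exists_entire_analyticOrderAt_eq m (hsupp ▸ hc)
    (hsupp ▸ (zeroSet_isClosed_and_isDiscrete hf h0).2.mono hS)
  obtain ⟨G, hG, hfG⟩ := exists_entire_mul_eq hf hF (fun z => by simp [hFo]) (fun z => by
    rw [hFo]
    by_cases hz : z ∈ S
    · exact (hmS z hz).le
    · simp [hm, hz])
  refine ⟨F, G, hF, hG, hfG, ?_, ?_⟩
  · ext z
    rw [← hm0 z, ← Nat.cast_ne_zero (R := ℕ∞), ← hFo, (hF.analyticAt z).analyticOrderAt_ne_zero]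
    rfl
  · refine Set.eq_empty_of_forall_notMem fun z ⟨hz, hzS⟩ => ?_
    have h1 : analyticOrderAt f z = analyticOrderAt F z + analyticOrderAt G z := by
      rw [← analyticOrderAt_mul (hF.analyticAt z) (hG.analyticAt z)]
      exact congrArg (analyticOrderAt · z) (funext hfG)
    have h2 : analyticOrderAt G z ≠ 0 := (hG.analyticAt z).analyticOrderAt_ne_zero.2 hz
    rw [hFo, hmS z hzS] at h1
    exact h2 (ENat.add_right_injective_of_ne_top (htop z) (by simpa using h1.symm))

theorem exists_entire_zeroSet_eq {S : Set ℂ} (hc : IsClosed S) (hd : IsDiscrete S) :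
    ∃ F : ℂ → ℂ, Differentiable ℂ F ∧ zeroSet F = S := by
  classical
  have hs : Function.support (S.indicator fun _ => (1 : ℕ)) = S := by ext; simp
  obtain ⟨F, hF, hFo⟩ := exists_entire_analyticOrderAt_eq (S.indicator fun _ => 1)
    (hs.symm ▸ hc) (hs.symm ▸ hd)
  refine ⟨F, hF, Set.ext fun z => ?_⟩
  have h := (hF.analyticAt z).analyticOrderAt_ne_zero
  rw [hFo] at h
  exact h.symm.trans (by simp)

end Entire

end DiscreteZ

namespace DiscreteZ

/-! ### Coprimality, prescribed zeros and splittings in the three rings. -/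

open ComplexConjugate

theorem mem_analyticFunctions_complex {f : ℂ → ℂ} :
    f ∈ analyticFunctions ℂ ↔ Differentiable ℂ f :=
  ⟨fun h z => (h z (Set.mem_univ z)).differentiableAt, fun h z _ => h.analyticAt z⟩

theorem isCoprime_entire (f g : analyticFunctions ℂ)
    (h : zeroSet (f : ℂ → ℂ) ∩ zeroSet (g : ℂ → ℂ) = ∅) : IsCoprime f g := by
  obtain ⟨u, v, hu, hv, huv⟩ := exists_bezout_entire (mem_analyticFunctions_complex.1 f.2)
    (mem_analyticFunctions_complex.1 g.2) h
  exact ⟨⟨u, mem_analyticFunctions_complex.2 hu⟩, ⟨v, mem_analyticFunctions_complex.2 hv⟩,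
    Subtype.ext (funext huv)⟩

/-- The conjugate `z ↦ conj (f (conj z))` of an entire function. -/
noncomputable def conjFun (f : ℂ → ℂ) : ℂ → ℂ := fun z => conj (f (conj z))

theorem differentiable_conjFun {f : ℂ → ℂ} (hf : Differentiable ℂ f) :
    Differentiable ℂ (conjFun f) := fun z => by
  have h := (hf (conj z)).conj_conj
  rwa [Complex.conj_conj] at h

theorem zeroSet_conjFun (f : ℂ → ℂ) : zeroSet (conjFun f) = conj '' zeroSet f := by
  ext z
  simp only [zeroSet, conjFun, Set.mem_ofPred_eq, map_eq_zero, Set.mem_image]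
  exact ⟨fun h => ⟨_, h, Complex.conj_conj z⟩, fun ⟨w, hw, h⟩ => by simp [← h, hw]⟩

theorem zeroSet_mul {𝕜 : Type} [RCLike 𝕜] (f g : 𝕜 → 𝕜) :
    zeroSet (f * g) = zeroSet f ∪ zeroSet g := by
  ext z
  simp [zeroSet]

/-- The entire functions with real Taylor coefficients are those that commute with conjugation. -/
theorem mem_realEntireFunctions {f : ℂ → ℂ} :
    f ∈ realEntireFunctions ↔ Differentiable ℂ f ∧ conjFun f = f := by
  constructor
  · intro h
    refine ⟨mem_analyticFunctions_complex.1 (realEntireFunctions_le h), funext fun z => ?_⟩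
    obtain ⟨a, ha⟩ := h
    have h1 := Complex.hasSum_conj'.2 (ha (conj z))
    simp only [map_mul, map_pow, Complex.conj_ofReal, Complex.conj_conj] at h1
    exact h1.unique (ha z)
  · rintro ⟨hf, hc⟩
    refine ⟨fun n => ((n.factorial : ℂ)⁻¹ * iteratedDeriv n f 0).re, fun z => ?_⟩
    have h1 := Complex.hasSum_taylorSeries_of_entire hf 0 z
    have h2 := Complex.hasSum_conj'.2 (Complex.hasSum_taylorSeries_of_entire hf 0 (conj z))
    have h3 : conj (f (conj z)) = f z := congrFun hc z
    rw [h3] at h2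
    -- Averaging the Taylor series of `f` with its conjugate replaces each coefficient by its real
    -- part.
    have h4 := (h1.add h2).mul_left (1 / 2)
    have h5 : 1 / 2 * (f z + f z) = f z := by ring
    rw [h5] at h4
    refine Eq.mp (congrArg (fun F : ℕ → ℂ => HasSum F (f z)) (funext fun n => ?_)) h4
    symm
    rw [Complex.re_eq_add_conj]
    simp only [smul_eq_mul, map_mul, map_inv₀, map_natCast, map_pow, Complex.conj_conj,
      sub_zero]
    ring

theorem conjFun_conjFun (f : ℂ → ℂ) : conjFun (conjFun f) = f := by
  funext z
  simp [conjFun]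

theorem conjFun_mul (f g : ℂ → ℂ) : conjFun (f * g) = conjFun f * conjFun g := by
  funext z
  simp [conjFun]

theorem mul_conjFun_mem {f : ℂ → ℂ} (hf : Differentiable ℂ f) :
    f * conjFun f ∈ realEntireFunctions := by
  refine mem_realEntireFunctions.2 ⟨hf.mul (differentiable_conjFun hf), ?_⟩
  rw [conjFun_mul, conjFun_conjFun, mul_comm]

theorem image_conj_zeroSet {f : ℂ → ℂ} (hf : f ∈ realEntireFunctions) :
    conj '' zeroSet f = zeroSet f := by
  rw [← zeroSet_conjFun, (mem_realEntireFunctions.1 hf).2]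

theorem image_conj_image_conj (S : Set ℂ) : conj '' (conj '' S) = S := by
  simp [Set.image_image]

/-- Averaging an entire Bezout identity with its conjugate gives cofactors with real coefficients,
since `f` and `g` are fixed by conjugation. -/
theorem isCoprime_realEntire (f g : realEntireFunctions)
    (h : zeroSet (f : ℂ → ℂ) ∩ zeroSet (g : ℂ → ℂ) = ∅) : IsCoprime f g := by
  obtain ⟨hf, hf'⟩ := mem_realEntireFunctions.1 f.2
  obtain ⟨hg, hg'⟩ := mem_realEntireFunctions.1 g.2
  obtain ⟨u, v, hu, hv, huv⟩ := exists_bezout_entire hf hg h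
  have hmem : ∀ {w : ℂ → ℂ}, Differentiable ℂ w →
      (fun z => 1 / 2 * (w z + conjFun w z)) ∈ realEntireFunctions := fun {w} hw => by
    refine mem_realEntireFunctions.2
      ⟨(hw.add (differentiable_conjFun hw)).const_mul _, funext fun z => ?_⟩
    have h2 : (starRingEnd ℂ) 2 = 2 := Complex.conj_ofNat 2
    simp [conjFun, add_comm, h2]
  refine ⟨⟨_, hmem hu⟩, ⟨_, hmem hv⟩, Subtype.ext (funext fun z => ?_)⟩
  have h1 := huv z
  have h2 := congrArg conj (huv (conj z))
  have h3 : conj ((f : ℂ → ℂ) (conj z)) = (f : ℂ → ℂ) z := congrFun hf' z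
  have h4 : conj ((g : ℂ → ℂ) (conj z)) = (g : ℂ → ℂ) z := congrFun hg' z
  simp only [map_add, map_mul, h3, h4, map_one] at h2
  show 1 / 2 * (u z + conj (u (conj z))) * (f : ℂ → ℂ) z +
    1 / 2 * (v z + conj (v (conj z))) * (g : ℂ → ℂ) z = 1
  linear_combination (1 / 2) * h1 + (1 / 2) * h2

/-- Without common zeros `f² + g²` is invertible, so the cofactors are `f` and `g` divided by it. -/
theorem isCoprime_realAnalytic (f g : analyticFunctions ℝ)
    (h : zeroSet (f : ℝ → ℝ) ∩ zeroSet (g : ℝ → ℝ) = ∅) : IsCoprime f g := by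
  have hne : ∀ x, (f : ℝ → ℝ) x * (f : ℝ → ℝ) x + (g : ℝ → ℝ) x * (g : ℝ → ℝ) x ≠ 0 := by
    intro x hx
    have : x ∈ zeroSet (f : ℝ → ℝ) ∩ zeroSet (g : ℝ → ℝ) := mul_self_add_mul_self_eq_zero.1 hx
    simp [h] at this
  have hmem : ∀ w : analyticFunctions ℝ, (fun x => (w : ℝ → ℝ) x /
      ((f : ℝ → ℝ) x * (f : ℝ → ℝ) x + (g : ℝ → ℝ) x * (g : ℝ → ℝ) x)) ∈ analyticFunctions ℝ :=
    fun w x hx => (w.2 x hx).div (((f.2 x hx).mul (f.2 x hx)).add ((g.2 x hx).mul (g.2 x hx)))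
      (hne x)
  refine ⟨⟨_, hmem f⟩, ⟨_, hmem g⟩, Subtype.ext (funext fun x => ?_)⟩
  have := hne x
  show _ / _ * (f : ℝ → ℝ) x + _ / _ * (g : ℝ → ℝ) x = 1
  rw [div_mul_eq_mul_div, div_mul_eq_mul_div, ← add_div, div_self this]

theorem exists_mem_entire_zeroSet_eq (Z : Set ℂ) (hc : IsClosed Z) (hd : IsDiscrete Z) :
    ∃ f : analyticFunctions ℂ, zeroSet (f : ℂ → ℂ) = Z := by
  obtain ⟨F, hF, hFZ⟩ := exists_entire_zeroSet_eq hc hd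
  exact ⟨⟨F, mem_analyticFunctions_complex.2 hF⟩, hFZ⟩

theorem exists_mem_realEntire_zeroSet_eq (Z : Set ℂ) (hc : IsClosed Z) (hd : IsDiscrete Z) :
    ∃ f : realEntireFunctions, zeroSet (f : ℂ → ℂ) = Z ∪ conj '' Z := by
  obtain ⟨F, hF, hFZ⟩ := exists_entire_zeroSet_eq hc hd
  exact ⟨⟨_, mul_conjFun_mem hF⟩, by rw [zeroSet_mul, zeroSet_conjFun, hFZ]⟩

/-- Take an entire `F` with zero set `Z`; on the real line `F * conjFun F` is `|F|²`, which is real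
and vanishes exactly on `Z`. -/
theorem exists_mem_realAnalytic_zeroSet_eq (Z : Set ℝ) (hc : IsClosed Z) (hd : IsDiscrete Z) :
    ∃ f : analyticFunctions ℝ, zeroSet (f : ℝ → ℝ) = Z := by
  obtain ⟨F, hF, hFZ⟩ := exists_entire_zeroSet_eq
    (Complex.isometry_ofReal.isClosedEmbedding.isClosedMap Z hc)
    (hd.image Complex.isometry_ofReal.isClosedEmbedding.isInducing)
  refine ⟨⟨fun x => ((F * conjFun F) x).re, fun x _ =>
    ((hF.mul (differentiable_conjFun hF)).analyticAt _).re_ofReal⟩, Set.ext fun x => ?_⟩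
  have h : F x = 0 ↔ x ∈ Z := by
    rw [show F x = 0 ↔ (x : ℂ) ∈ zeroSet F from Iff.rfl, hFZ]
    simp
  rw [← h]
  simp [zeroSet, conjFun, Complex.mul_conj]

theorem inter_zeroSet_isClosed {A : Subring (ℂ → ℂ)} (hA : A ≤ analyticFunctions ℂ) (f g : A) :
    IsClosed (zeroSet (f : ℂ → ℂ) ∩ zeroSet (g : ℂ → ℂ)) := by
  have h : ∀ f : A, IsClosed (zeroSet (f : ℂ → ℂ)) := fun f =>
    isClosed_eq (mem_analyticFunctions_complex.1 (hA f.2)).continuous continuous_const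
  exact (h f).inter (h g)

theorem exists_split_entire (f g : analyticFunctions ℂ) :
    ∃ F G : analyticFunctions ℂ, F * G ∈ Ideal.span {f, g} ∧
      zeroSet (F : ℂ → ℂ) ⊆ zeroSet (f : ℂ → ℂ) ∩ zeroSet (g : ℂ → ℂ) ∧
      zeroSet (G : ℂ → ℂ) ∩ zeroSet (g : ℂ → ℂ) = ∅ := by
  by_cases h0 : ∃ z, (f : ℂ → ℂ) z ≠ 0
  · obtain ⟨F, G, hF, hG, hfFG, hFz, hGz⟩ := exists_entire_split
      (mem_analyticFunctions_complex.1 f.2) h0 (inter_zeroSet_isClosed le_rfl f g)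
      Set.inter_subset_left
    refine ⟨⟨F, mem_analyticFunctions_complex.2 hF⟩, ⟨G, mem_analyticFunctions_complex.2 hG⟩, ?_,
      hFz.subset, ?_⟩
    · have : (⟨F, mem_analyticFunctions_complex.2 hF⟩ : analyticFunctions ℂ) *
          ⟨G, mem_analyticFunctions_complex.2 hG⟩ = f :=
        Subtype.ext (funext fun z => (hfFG z).symm)
      rw [this]
      exact Ideal.subset_span (by simp)
    · refine Set.eq_empty_of_forall_notMem fun z ⟨hz, hgz⟩ => ?_
      have hz' : G z = 0 := hz
      have : z ∈ zeroSet G ∩ (zeroSet (f : ℂ → ℂ) ∩ zeroSet (g : ℂ → ℂ)) :=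
        ⟨hz, by simp [zeroSet, hfFG, hz'], hgz⟩
      simp [hGz] at this
  · push Not at h0
    refine ⟨g, 1, by simpa using Ideal.subset_span (by simp), ?_, by simp [zeroSet]⟩
    exact fun z hz => ⟨h0 z, hz⟩

/-- The entire factors of `f` need not have real coefficients, but multiplied by their conjugates
they do. Their product becomes `f²`, still in the ideal, and the zero set conditions survive because
those of `f` and `g` are invariant. -/
theorem exists_split_realEntire (f g : realEntireFunctions) :
    ∃ F G : realEntireFunctions, F * G ∈ Ideal.span {f, g} ∧
      zeroSet (F : ℂ → ℂ) ⊆ zeroSet (f : ℂ → ℂ) ∩ zeroSet (g : ℂ → ℂ) ∧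
      zeroSet (G : ℂ → ℂ) ∩ zeroSet (g : ℂ → ℂ) = ∅ := by
  by_cases h0 : ∃ z, (f : ℂ → ℂ) z ≠ 0
  · obtain ⟨hf, hf'⟩ := mem_realEntireFunctions.1 f.2
    obtain ⟨F, G, hF, hG, hfFG, hFz, hGz⟩ := exists_entire_split hf h0
      (inter_zeroSet_isClosed realEntireFunctions_le f g) Set.inter_subset_left
    have hdisj : zeroSet G ∩ zeroSet (g : ℂ → ℂ) = ∅ := by
      refine Set.eq_empty_of_forall_notMem fun z ⟨hz, hgz⟩ => ?_
      have hz' : G z = 0 := hz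
      have : z ∈ zeroSet G ∩ (zeroSet (f : ℂ → ℂ) ∩ zeroSet (g : ℂ → ℂ)) :=
        ⟨hz, by simp [zeroSet, hfFG, hz'], hgz⟩
      simp [hGz] at this
    have hinj : Function.Injective (conj : ℂ → ℂ) := (starRingEnd ℂ).injective
    refine ⟨⟨_, mul_conjFun_mem hF⟩, ⟨_, mul_conjFun_mem hG⟩, ?_, ?_, ?_⟩
    · have hfFG' : (f : ℂ → ℂ) = F * G := funext hfFG
      have : (⟨_, mul_conjFun_mem hF⟩ : realEntireFunctions) * ⟨_, mul_conjFun_mem hG⟩ = f * f := by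
        refine Subtype.ext ?_
        show F * conjFun F * (G * conjFun G) = (f : ℂ → ℂ) * (f : ℂ → ℂ)
        nth_rw 2 [← hf']
        rw [hfFG', conjFun_mul]
        ring
      rw [this]
      exact Ideal.mul_mem_left _ _ (Ideal.subset_span (by simp))
    · rw [zeroSet_mul, zeroSet_conjFun, hFz, Set.image_inter hinj, image_conj_zeroSet f.2,
        image_conj_zeroSet g.2, Set.union_self]
    · rw [zeroSet_mul, zeroSet_conjFun, Set.union_inter_distrib_right, hdisj, Set.empty_union,
        ← image_conj_zeroSet g.2, ← Set.image_inter hinj, hdisj, Set.image_empty]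
  · push Not at h0
    refine ⟨g, 1, by simpa using Ideal.subset_span (by simp), ?_, by simp [zeroSet]⟩
    exact fun z hz => ⟨h0 z, hz⟩

theorem exists_split_realAnalytic (f g : analyticFunctions ℝ) :
    ∃ F G : analyticFunctions ℝ, F * G ∈ Ideal.span {f, g} ∧
      zeroSet (F : ℝ → ℝ) ⊆ zeroSet (f : ℝ → ℝ) ∩ zeroSet (g : ℝ → ℝ) ∧
      zeroSet (G : ℝ → ℝ) ∩ zeroSet (g : ℝ → ℝ) = ∅ := by
  refine ⟨f * f + g * g, 1, ?_, fun x hx => mul_self_add_mul_self_eq_zero.1 hx, by simp [zeroSet]⟩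
  rw [mul_one]
  exact Ideal.add_mem _ (Ideal.mul_mem_left _ _ (Ideal.subset_span (by simp)))
    (Ideal.mul_mem_left _ _ (Ideal.subset_span (by simp)))

/-! ### Conjugation and the ring with real coefficients. -/

theorem image_conj_mem_closedDiscreteSets {Z : Set ℂ} (hZ : Z ∈ closedDiscreteSets ℂ) :
    conj '' Z ∈ closedDiscreteSets ℂ := by
  have hh : IsHomeomorph (conj : ℂ → ℂ) := (Complex.conjLIE.toHomeomorph).isHomeomorph
  rcases hZ with ⟨hc, hd⟩ | rfl
  · exact Or.inl ⟨hh.isClosedMap Z hc, hd.image hh.isInducing⟩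
  · exact Or.inr (Set.image_univ_of_surjective hh.surjective)

theorem zeroSets_idealAt_realEntire (p : Theta ℂ) :
    zeroSets (idealAt realEntireFunctions realEntireFunctions_le p) =
      {Z ∈ p.sets | conj '' Z = Z} := by
  refine Set.Subset.antisymm ?_ ?_
  · rintro _ ⟨f, hf, rfl⟩
    exact ⟨hf, image_conj_zeroSet f.2⟩
  · rintro Z ⟨hZ, hconj⟩
    obtain ⟨f, rfl⟩ : ∃ f : realEntireFunctions, zeroSet (f : ℂ → ℂ) = Z := by
      rcases p.isDiscreteZFilter.subset hZ with ⟨hc, hd⟩ | rfl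
      · obtain ⟨f, hf⟩ := exists_mem_realEntire_zeroSet_eq Z hc hd
        exact ⟨f, by rw [hf, hconj, Set.union_self]⟩
      · exact ⟨0, by simp [zeroSet]⟩
    exact ⟨f, hZ, rfl⟩

theorem idealAt_realEntire_eq_iff (p q : Theta ℂ) :
    idealAt realEntireFunctions realEntireFunctions_le p =
        idealAt realEntireFunctions realEntireFunctions_le q ↔
      p = q ∨ p.sets = (fun Z => conj '' Z) '' q.sets := by
  constructor
  · intro h
    have hinv : ∀ Z, conj '' Z = Z → Z ∈ p.sets → Z ∈ q.sets := by
      intro Z hZ hp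
      have h1 : Z ∈ zeroSets (idealAt realEntireFunctions realEntireFunctions_le p) := by
        rw [zeroSets_idealAt_realEntire]
        exact ⟨hp, hZ⟩
      rw [h, zeroSets_idealAt_realEntire] at h1
      exact h1.1
    by_cases hpq : p.sets ⊆ q.sets
    · exact Or.inl (Theta.eq_of_subset hpq)
    right
    -- For `W` in `D^p` put `X = Z ∩ W`. The invariant set `X ∪ conj '' X` lies in `D^p`, hence in
    -- `D^q`; primeness leaves only `conj '' X`, since `X ⊆ Z` and `Z` is not in `D^q`.
    obtain ⟨Z, hZp, hZq⟩ := Set.not_subset.1 hpq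
    have hsub : ∀ W ∈ p.sets, conj '' W ∈ q.sets := by
      intro W hW
      have hXp := p.isDiscreteZFilter.inter_mem _ hZp _ hW
      have hX := p.isDiscreteZFilter.subset hXp
      have hX' := image_conj_mem_closedDiscreteSets hX
      have hu := hinv _ (by rw [Set.image_union, image_conj_image_conj, Set.union_comm])
        (p.mem_of_superset hXp (union_mem_closedDiscreteSets hX hX') Set.subset_union_left)
      rcases q.mem_or_mem_of_union_mem hX hX' hu with h1 | h1
      · exact absurd (q.mem_of_superset h1 (p.isDiscreteZFilter.subset hZp)
          Set.inter_subset_left) hZq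
      · exact q.mem_of_superset h1
          (image_conj_mem_closedDiscreteSets (p.isDiscreteZFilter.subset hW))
          (Set.image_mono Set.inter_subset_right)
    -- The conjugate of `D^q` is a filter containing `D^p`, so maximality of `D^p` forces equality.
    have hF : IsDiscreteZFilter ((fun Z => conj '' Z) '' q.sets) :=
      { subset := by
          rintro _ ⟨Z, hZ, rfl⟩
          exact image_conj_mem_closedDiscreteSets (q.isDiscreteZFilter.subset hZ)
        empty_notMem := by
          rintro ⟨Z, hZ, h⟩
          rw [Set.image_eq_empty.1 h] at hZ
          exact q.isDiscreteZFilter.empty_notMem hZ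
        inter_mem := by
          rintro _ ⟨Z, hZ, rfl⟩ _ ⟨W, hW, rfl⟩
          exact ⟨Z ∩ W, q.isDiscreteZFilter.inter_mem _ hZ _ hW,
            Set.image_inter (starRingEnd ℂ).injective⟩
        mem_of_superset := by
          rintro _ ⟨Z, hZ, rfl⟩ D hD hs
          refine ⟨conj '' D, q.mem_of_superset hZ (image_conj_mem_closedDiscreteSets hD) ?_,
            image_conj_image_conj D⟩
          rw [← image_conj_image_conj Z]
          exact Set.image_mono hs }
    exact (p.maximal _ hF fun W hW => ⟨_, hsub W hW, image_conj_image_conj W⟩).symm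
  · rintro (rfl | h)
    · rfl
    · ext f
      rw [mem_idealAt, mem_idealAt, h]
      constructor
      · rintro ⟨Z, hZ, hZf⟩
        rw [← image_conj_zeroSet f.2, ← hZf]
        simpa only [image_conj_image_conj] using hZ
      · exact fun hf => ⟨_, hf, image_conj_zeroSet f.2⟩

/-! ### Assembling the correspondence. -/

/-- The correspondence between maximal ideals and discrete `z`-ultrafilters for a ring in which every
closed discrete set is a zero set. -/
theorem maximalIdeal_correspondence {𝕜 : Type} [RCLike 𝕜]
    (hcop : ∀ f g : analyticFunctions 𝕜,
      zeroSet (f : 𝕜 → 𝕜) ∩ zeroSet (g : 𝕜 → 𝕜) = ∅ → IsCoprime f g)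
    (hsplit : ∀ f g : analyticFunctions 𝕜, ∃ F G : analyticFunctions 𝕜,
      F * G ∈ Ideal.span {f, g} ∧
      zeroSet (F : 𝕜 → 𝕜) ⊆ zeroSet (f : 𝕜 → 𝕜) ∩ zeroSet (g : 𝕜 → 𝕜) ∧
      zeroSet (G : 𝕜 → 𝕜) ∩ zeroSet (g : 𝕜 → 𝕜) = ∅)
    (hzero : ∀ Z : Set 𝕜, IsClosed Z → IsDiscrete Z →
      ∃ f : analyticFunctions 𝕜, zeroSet (f : 𝕜 → 𝕜) = Z) :
    (∀ p : Theta 𝕜,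
        (idealAt (analyticFunctions 𝕜) le_rfl p).IsMaximal ∧
        zeroSets (idealAt (analyticFunctions 𝕜) le_rfl p) = p.sets ∧
        (idealAt (analyticFunctions 𝕜) le_rfl p : Set (analyticFunctions 𝕜)) =
          {f : analyticFunctions 𝕜 | p ∈ closure (eta '' zeroSet (f : 𝕜 → 𝕜))}) ∧
      (∀ M : Ideal (analyticFunctions 𝕜), M.IsMaximal →
        ∃! p : Theta 𝕜, M = idealAt (analyticFunctions 𝕜) le_rfl p) := by
  refine ⟨fun p => ⟨idealAt_isMaximal _ hcop (fun Z hc hd f hZf => ?_) p,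
    zeroSets_idealAt _ hzero p, idealAt_eq_closure _ p⟩, fun M hM => ?_⟩
  · obtain ⟨g, hg⟩ := hzero Z hc hd
    exact ⟨g, hg.ge, by rw [hg, hZf]⟩
  · obtain ⟨p, rfl⟩ := exists_eq_idealAt le_rfl hcop hsplit hM
    refine ⟨p, rfl, fun q hq => Theta.ext ?_⟩
    rw [← zeroSets_idealAt le_rfl hzero p, ← zeroSets_idealAt le_rfl hzero q, hq]

/-- The extra zeros on `conj '' Z` are harmless: the zero set of `f` is invariant, so it misses
`conj '' Z` whenever it misses `Z`. -/
theorem idealAt_realEntire_isMaximal (p : Theta ℂ) :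
    (idealAt realEntireFunctions realEntireFunctions_le p).IsMaximal := by
  refine idealAt_isMaximal _ isCoprime_realEntire (fun Z hc hd f hZf => ?_) p
  obtain ⟨g, hg⟩ := exists_mem_realEntire_zeroSet_eq Z hc hd
  refine ⟨g, hg ▸ Set.subset_union_left, ?_⟩
  rw [hg, Set.union_inter_distrib_right, hZf, Set.empty_union, ← image_conj_zeroSet f.2,
    ← Set.image_inter (starRingEnd ℂ).injective, hZf, Set.image_empty]

end DiscreteZ

theorem theorem3p11 :
    -- the ring of entire functions of one complex variable
    ((∀ p : Theta ℂ,
        (idealAt (analyticFunctions ℂ) le_rfl p).IsMaximal ∧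
        zeroSets (idealAt (analyticFunctions ℂ) le_rfl p) = p.sets ∧
        (idealAt (analyticFunctions ℂ) le_rfl p : Set (analyticFunctions ℂ)) =
          {f : analyticFunctions ℂ | p ∈ closure (eta '' zeroSet (f : ℂ → ℂ))}) ∧
      (∀ M : Ideal (analyticFunctions ℂ), M.IsMaximal →
        ∃! p : Theta ℂ, M = idealAt (analyticFunctions ℂ) le_rfl p)) ∧
    -- the ring of real analytic functions on the real line
    ((∀ p : Theta ℝ,
        (idealAt (analyticFunctions ℝ) le_rfl p).IsMaximal ∧
        zeroSets (idealAt (analyticFunctions ℝ) le_rfl p) = p.sets ∧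
        (idealAt (analyticFunctions ℝ) le_rfl p : Set (analyticFunctions ℝ)) =
          {f : analyticFunctions ℝ | p ∈ closure (eta '' zeroSet (f : ℝ → ℝ))}) ∧
      (∀ M : Ideal (analyticFunctions ℝ), M.IsMaximal →
        ∃! p : Theta ℝ, M = idealAt (analyticFunctions ℝ) le_rfl p)) ∧
    -- the ring of entire functions of one complex variable with real coefficients
    ((∀ p : Theta ℂ,
        (idealAt realEntireFunctions realEntireFunctions_le p).IsMaximal ∧
        zeroSets (idealAt realEntireFunctions realEntireFunctions_le p) =
          {Z ∈ p.sets | (starRingEnd ℂ) '' Z = Z} ∧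
        (idealAt realEntireFunctions realEntireFunctions_le p : Set realEntireFunctions) =
          {f : realEntireFunctions | p ∈ closure (eta '' zeroSet (f : ℂ → ℂ))}) ∧
      (∀ M : Ideal realEntireFunctions, M.IsMaximal →
        ∃ p : Theta ℂ, M = idealAt realEntireFunctions realEntireFunctions_le p) ∧
      (∀ p q : Theta ℂ,
        idealAt realEntireFunctions realEntireFunctions_le p =
            idealAt realEntireFunctions realEntireFunctions_le q ↔
          p = q ∨ p.sets = (fun Z => (starRingEnd ℂ) '' Z) '' q.sets)) := by

  refine ⟨maximalIdeal_correspondence isCoprime_entire exists_split_entire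
      exists_mem_entire_zeroSet_eq,
    maximalIdeal_correspondence isCoprime_realAnalytic exists_split_realAnalytic
      exists_mem_realAnalytic_zeroSet_eq,
    fun p => ⟨idealAt_realEntire_isMaximal p, zeroSets_idealAt_realEntire p,
      idealAt_eq_closure _ p⟩,
    fun M hM => exists_eq_idealAt _ isCoprime_realEntire exists_split_realEntire hM,
    idealAt_realEntire_eq_iff⟩
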